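/- Let $N\ge 2$ be an integer and $\Delta>0$, and let $A_N\subset\mathbb{C}$ be the ring constellation $$A_N=\{0\}\cup\bigcup_{n=1}^{N-1}\Big\{\big(n+\tfrac12\big)\Delta\, e^{i(l+\frac12)\theta_n}: l=0,1,\dots,2n\Big\},\qquad \theta_n=\frac{2\pi}{2n+1},$$ which has $N^2$ points. Let $X$ be uniformly distributed on $A_N$ and let $Y=X+Z$, where $Z=Z_R+iZ_I$ is independent of $X$ and $Z_R,Z_I$ are independent real Gaussian random variables with mean $0$ and variance $1$. Put $P_N=\mathbb{E}[|X|^2]$ and $\tilde C=\log_2(1+P_N/2)$, and define $\alpha>0$ by $N^2=\alpha(1+P_N/2)$. Then the mutual information $I(X;Y)$, measured in bits, satisfies $$I(X;Y)\ \ge\ \tilde C-0.45-\log_2\!\Big(1+\frac{1.82}{\alpha}+O\Big(\frac1{N^2}\Big)\Big).$$ More precisely, there is a sequence $(\varepsilon_N)_N$ of real numbers, not depending on $\Delta$ or $\alpha$, with $\varepsilon_N=O(1/N^2)$ as $N\to\infty$, such that for all $N\ge2$ and all $\Delta,\alpha>0$ with $N^2=\alpha(1+P_N/2)$ one has $1+\frac{1.82}{\alpha}+\varepsilon_N>0$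 and $I(X;Y)\ge \tilde C-0.45-\log_2\big(1+\frac{1.82}{\alpha}+\varepsilon_N\big)$. -/

import Mathlib

/-- The two-dimensional ring constellation with spacing `Δ`: the origin together with, for each
`n = 1, …, N - 1`, the `2 n + 1` equally spaced points
`(n + 1/2) Δ exp (i (l + 1/2) θₙ)`, `l = 0, …, 2 n`, where `θₙ = 2 π / (2 n + 1)`. -/
noncomputable def ringConstellation (N : ℕ) (Δ : ℝ) : Set ℂ :=
  {0} ∪ ⋃ n ∈ Set.Ico 1 N,
    (fun l : ℕ => (((n : ℝ) + 1 / 2) * Δ : ℝ) *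
      Complex.exp (Complex.I * (((l : ℝ) + 1 / 2) * (2 * Real.pi / (2 * (n : ℝ) + 1)) : ℝ))) ''
        Set.Iic (2 * n)

/-- `Z = Z_R + i Z_I` is complex Gaussian noise whose real and imaginary parts are independent
Gaussian random variables with mean `0` and variance `1`. -/
structure IsComplexGaussianNoise {Ω : Type*} [MeasurableSpace Ω] (μ : MeasureTheory.Measure Ω)
    (Z : Ω → ℂ) : Prop where
  law_re : ProbabilityTheory.HasLaw (fun ω => (Z ω).re) (ProbabilityTheory.gaussianReal 0 1) μ
  law_im : ProbabilityTheory.HasLaw (fun ω => (Z ω).im) (ProbabilityTheory.gaussianReal 0 1) μ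
  indep : ProbabilityTheory.IndepFun (fun ω => (Z ω).re) (fun ω => (Z ω).im) μ

/-- The mutual information `I(X;Y)` in bits: the Kullback-Leibler divergence of the joint law
from the product of the marginal laws, divided by `log 2` to convert from nats. -/
noncomputable def mutualInfoBits {Ω E F : Type*} [MeasurableSpace Ω] [MeasurableSpace E]
    [MeasurableSpace F] (μ : MeasureTheory.Measure Ω) (X : Ω → E) (Y : Ω → F) : ENNReal :=
  InformationTheory.klDiv (μ.map (fun ω => (X ω, Y ω))) ((μ.map X).prod (μ.map Y)) /
    ENNReal.ofReal (Real.log 2)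

/-- The average power `E[|X|²]` of a complex random variable. -/
noncomputable def averagePower {Ω : Type*} [MeasurableSpace Ω] (μ : MeasureTheory.Measure Ω)
    (X : Ω → ℂ) : ℝ :=
  ∫ ω, ‖X ω‖ ^ 2 ∂μ

/-!
The bound is of Ozarow-Wyner type. Cut the disc of radius `N Δ` into polar cells of equal area
`π Δ ^ 2`, one around each constellation point: ring `n` is the annulus `n Δ < r < (n + 1) Δ`, cut
into `2 n + 1` equal sectors, and the origin owns the disc of radius `Δ`. If `U` is uniform on the
cell of `X`, then `U` is uniform on the disc, `U - X - Y` is a Markov chain, and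
`I(X;Y) ≥ I(U;Y) ≥ h(U) - log (π e E|U - k Y|²)` for every real `k`.

No density of `Y` and no differential entropy is needed to prove this. For `D > 0`, apply the
Donsker-Varadhan inequality (`ofReal_integral_le_klDiv_of_integral_exp_le_one`) to
`f (x, y) = log (N² Δ² / D) - E[|U - k y|² | X = x] / D`. Under the joint law, only second moments
enter, and `E f ≥ log (N² Δ² / D) - 1` once `D ≥ E|U - k Y|²`. Under the product of the marginals,
`E exp f ≤ 1` holds for each value of `y`: by Jensen's inequality on every cell the average over
`x` is at most the Gaussian integral over the disc, divided by `π D` (`sum_exp_neg_le`). The two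
facts combine in `log_sub_one_le_klDiv_map_prodMk`.

It remains to bound `E|U - k Y|²` for `k = P / (P + 2)`. With `α (1 + P / 2) = N²`, it is at most
`Δ² (α + 1.82) / 2` (`distortion_le`). Here `(1 + π²) / 12 < 0.91` is the limiting second moment
of a cell about its point in units of `Δ²`, and `sin x ≥ x - x³ / 6` controls the centroids of the
cells. Since `e / 2 ≤ 2 ^ 0.45`, the asserted bound follows for every `N ≥ 2` with `ε = 0`.
-/

open MeasureTheory ProbabilityTheory InformationTheory
open scoped ENNReal ComplexConjugate


/-! ### An information lower bound for additive Gaussian noise -/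

/-- The Donsker-Varadhan lower bound for the Kullback-Leibler divergence: Gibbs' inequality
against the tilted measure `Q.tilted f`. -/
theorem ofReal_integral_le_klDiv_of_integral_exp_le_one {E : Type*} [MeasurableSpace E]
    {P Q : Measure E} [IsProbabilityMeasure P] [IsProbabilityMeasure Q] {f : E → ℝ}
    (hf : Integrable f P) (hexp : Integrable (fun x => Real.exp (f x)) Q)
    (hle : ∫ x, Real.exp (f x) ∂Q ≤ 1) :
    ENNReal.ofReal (∫ x, f x ∂P) ≤ klDiv P Q := by
  by_cases htop : klDiv P Q = ∞
  · simp [htop]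
  obtain ⟨hac, hllr⟩ := klDiv_ne_top_iff.1 htop
  have : IsProbabilityMeasure (Q.tilted f) := isProbabilityMeasure_tilted hexp
  have hac' : P ≪ Q.tilted f := hac.trans (absolutelyContinuous_tilted hexp)
  have hgibbs := integral_llr_add_sub_measure_univ_nonneg hac'
    (integrable_llr_tilted_right hac hf hllr hexp)
  rw [integral_llr_tilted_right hac hf hexp hllr] at hgibbs
  have hlog : Real.log (∫ x, Real.exp (f x) ∂Q) ≤ 0 :=
    Real.log_nonpos (integral_nonneg fun x => (Real.exp_pos _).le) hle
  rw [← ENNReal.ofReal_toReal htop, toReal_klDiv_of_measure_eq hac (by simp)]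
  apply ENNReal.ofReal_le_ofReal
  simp only [probReal_univ] at hgibbs
  linarith

theorem uniformOn_finset_eq {E : Type*} [MeasurableSpace E] [MeasurableSingletonClass E]
    (S : Finset E) :
    uniformOn (S : Set E) = (S.card : ℝ≥0∞)⁻¹ • Measure.count.restrict (S : Set E) := by
  rw [uniformOn, ProbabilityTheory.cond, Measure.count_apply_finset]

theorem integrableOn_count_finset {E : Type*} [MeasurableSpace E] [MeasurableSingletonClass E]
    (S : Finset E) (g : E → ℝ) : IntegrableOn g (S : Set E) Measure.count := by
  have : IsFiniteMeasure (Measure.count.restrict (S : Set E)) :=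
    ⟨by simp⟩
  have h : IntegrableOn g (S : Set E) (Measure.count.restrict (S : Set E)) := IntegrableOn.finset
  rwa [IntegrableOn, Measure.restrict_restrict_of_subset subset_rfl] at h

theorem integrable_uniformOn_finset {E : Type*} [MeasurableSpace E] [MeasurableSingletonClass E]
    {S : Finset E} (hS : S.Nonempty) (g : E → ℝ) : Integrable g (uniformOn (S : Set E)) := by
  rw [uniformOn_finset_eq]
  exact Integrable.smul_measure (integrableOn_count_finset S g) (by simp [hS.ne_empty])

theorem integral_uniformOn_finset {E : Type*} [MeasurableSpace E] [MeasurableSingletonClass E]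
    (S : Finset E) (g : E → ℝ) :
    ∫ x, g x ∂(uniformOn (S : Set E)) = (∑ x ∈ S, g x) / S.card := by
  rw [uniformOn_finset_eq, integral_smul_measure, setIntegral_finset _ (integrableOn_count_finset S g)]
  simp [Measure.real, div_eq_inv_mul]

theorem IsComplexGaussianNoise.aemeasurable {Ω : Type*} [MeasurableSpace Ω] {μ : Measure Ω}
    {Z : Ω → ℂ} (hZ : IsComplexGaussianNoise μ Z) : AEMeasurable Z μ := by
  have h := (Complex.measurable_ofReal.comp_aemeasurable hZ.law_re.aemeasurable).add
    ((Complex.measurable_ofReal.comp_aemeasurable hZ.law_im.aemeasurable).mul_const Complex.I)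
  convert h using 1
  ext ω
  simp [Complex.re_add_im]

theorem integrable_sq_and_integral_of_hasLaw_gaussianReal {Ω : Type*} [MeasurableSpace Ω]
    {μ : Measure Ω} {V : Ω → ℝ} (hV : HasLaw V (gaussianReal 0 1) μ) :
    Integrable V μ ∧ Integrable (fun ω => V ω ^ 2) μ ∧ ∫ ω, V ω ∂μ = 0 ∧ ∫ ω, V ω ^ 2 ∂μ = 1 := by
  have hid : MemLp (id : ℝ → ℝ) 2 (gaussianReal 0 1) := memLp_id_gaussianReal 2
  have hid1 : Integrable (fun x : ℝ => x) (gaussianReal 0 1) :=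
    hid.integrable (by norm_num)
  have hid2 : Integrable (fun x : ℝ => x ^ 2) (gaussianReal 0 1) := hid.integrable_sq
  have hsq : ∫ x : ℝ, x ^ 2 ∂(gaussianReal 0 1) = 1 := by
    have h := variance_fun_id_gaussianReal (μ := 0) (v := 1)
    rw [variance_eq_integral aemeasurable_id'] at h
    simpa using h
  have hmap := hV.map_eq
  refine ⟨?_, ?_, ?_, ?_⟩
  · rw [← hmap] at hid1
    exact hid1.comp_aemeasurable hV.aemeasurable
  · rw [← hmap] at hid2
    exact hid2.comp_aemeasurable hV.aemeasurable
  · rw [hV.integral_eq]; simp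
  · rw [← hsq, ← hV.integral_comp (f := fun x => x ^ 2) (by fun_prop)]
    rfl

theorem IsComplexGaussianNoise.integral_norm_sq {Ω : Type*} [MeasurableSpace Ω] {μ : Measure Ω}
    {Z : Ω → ℂ} (hZ : IsComplexGaussianNoise μ Z) :
    Integrable (fun ω => ‖Z ω‖ ^ 2) μ ∧ ∫ ω, ‖Z ω‖ ^ 2 ∂μ = 2 := by
  obtain ⟨-, hr, -, hr'⟩ := integrable_sq_and_integral_of_hasLaw_gaussianReal hZ.law_re
  obtain ⟨-, hi, -, hi'⟩ := integrable_sq_and_integral_of_hasLaw_gaussianReal hZ.law_im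
  have h : (fun ω => ‖Z ω‖ ^ 2) = fun ω => (Z ω).re ^ 2 + (Z ω).im ^ 2 := by
    ext ω
    rw [Complex.sq_norm, Complex.normSq_apply]
    ring
  rw [h]
  refine ⟨hr.add hi, ?_⟩
  rw [integral_add hr hi, hr', hi']
  norm_num

/-- Cross terms between a centred noise and an independent signal vanish. -/
theorem IsComplexGaussianNoise.integral_re_mul_conj_eq_zero {Ω : Type*} [MeasurableSpace Ω]
    {μ : Measure Ω} {X Z : Ω → ℂ} (hZ : IsComplexGaussianNoise μ Z) (hXZ : IndepFun X Z μ)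
    {g : ℂ → ℂ} (hg : Measurable g) (hre : Integrable (fun ω => (g (X ω)).re) μ)
    (him : Integrable (fun ω => (g (X ω)).im) μ) :
    Integrable (fun ω => (g (X ω) * conj (Z ω)).re) μ ∧
      ∫ ω, (g (X ω) * conj (Z ω)).re ∂μ = 0 := by
  obtain ⟨hr, -, hr', -⟩ := integrable_sq_and_integral_of_hasLaw_gaussianReal hZ.law_re
  obtain ⟨hi, -, hi', -⟩ := integrable_sq_and_integral_of_hasLaw_gaussianReal hZ.law_im
  have indr : IndepFun (fun ω => (g (X ω)).re) (fun ω => (Z ω).re) μ :=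
    hXZ.comp (Complex.measurable_re.comp hg) Complex.measurable_re
  have indi : IndepFun (fun ω => (g (X ω)).im) (fun ω => (Z ω).im) μ :=
    hXZ.comp (Complex.measurable_im.comp hg) Complex.measurable_im
  have h : (fun ω => (g (X ω) * conj (Z ω)).re)
      = fun ω => (g (X ω)).re * (Z ω).re + (g (X ω)).im * (Z ω).im := by
    ext ω
    simp
  have h1 := indr.integrable_mul hre hr
  have h2 := indi.integrable_mul him hi
  have e1 := indr.integral_mul_eq_mul_integral hre.aestronglyMeasurable hr.aestronglyMeasurable
  have e2 := indi.integral_mul_eq_mul_integral him.aestronglyMeasurable hi.aestronglyMeasurable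
  simp only [Pi.mul_def] at h1 h2 e1 e2
  rw [h]
  refine ⟨h1.add h2, ?_⟩
  rw [integral_add h1 h2, e1, e2, hr', hi']
  simp

/-- A lower bound for the information that `X + Z` carries about a uniform constellation point `X`.

Each point `x` owns a cell with centroid `m x` and mean squared modulus `b x`, so that
`b x + ‖w‖ ^ 2 - 2 Re (m x * conj w)` is the mean squared distance from `w` to the cell. The
hypothesis `hcover` says that the Gaussian weights of the cells, with variance parameter `D`, have
total mass at most `1` around every centre `w`; `hdist` says that `k Y` estimates a uniform point
of the cell of `X` with mean squared error at most `D`. The Donsker-Varadhan test function is the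
logarithm of the Gaussian weight of the cell of `X` around `k Y`. -/
theorem log_sub_one_le_klDiv_map_prodMk {Ω : Type*} [MeasurableSpace Ω] {μ : Measure Ω}
    [IsProbabilityMeasure μ] {X Z : Ω → ℂ} {S : Finset ℂ} (hS : S.Nonempty)
    (hX : HasLaw X (uniformOn (S : Set ℂ)) μ) (hZ : IsComplexGaussianNoise μ Z)
    (hXZ : IndepFun X Z μ) {m : ℂ → ℂ} {b : ℂ → ℝ} (hm : Measurable m) (hb : Measurable b)
    {k D K : ℝ} (hD : 0 < D) (hK : 0 < K)
    (hcover : ∀ w : ℂ, K * ∑ x ∈ S,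
      Real.exp (-(b x + ‖w‖ ^ 2 - 2 * (m x * conj w).re) / D) ≤ S.card)
    (hdist : (∑ x ∈ S, (b x + k ^ 2 * ‖x‖ ^ 2 - 2 * k * (m x * conj x).re)) / S.card
      + 2 * k ^ 2 ≤ D) :
    ENNReal.ofReal (Real.log K - 1) ≤
      klDiv (μ.map fun ω => (X ω, X ω + Z ω)) ((μ.map X).prod (μ.map fun ω => X ω + Z ω)) := by
  have hXm := hX.aemeasurable
  have hYm : AEMeasurable (fun ω => X ω + Z ω) μ := hXm.add hZ.aemeasurable
  have hXYm : AEMeasurable (fun ω => (X ω, X ω + Z ω)) μ := hXm.prodMk hYm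
  have : IsProbabilityMeasure (μ.map X) := Measure.isProbabilityMeasure_map hXm
  have : IsProbabilityMeasure (μ.map fun ω => X ω + Z ω) := Measure.isProbabilityMeasure_map hYm
  have : IsProbabilityMeasure (μ.map fun ω => (X ω, X ω + Z ω)) :=
    Measure.isProbabilityMeasure_map hXYm
  have hint : ∀ g : ℂ → ℝ, Integrable (fun ω => g (X ω)) μ := fun g => by
    have h := integrable_uniformOn_finset hS g
    rw [← hX.map_eq] at h
    exact h.comp_aemeasurable hXm
  have hcard : (0 : ℝ) < S.card := by exact_mod_cast hS.card_pos
  set f : ℂ × ℂ → ℝ := fun p => Real.log K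
    - (b p.1 + ‖(k : ℂ) * p.2‖ ^ 2 - 2 * (m p.1 * conj ((k : ℂ) * p.2)).re) / D with hf
  have hfm : Measurable f := by
    have h1 : Measurable fun p : ℂ × ℂ => b p.1 := hb.comp measurable_fst
    have h2 : Measurable fun p : ℂ × ℂ => m p.1 := hm.comp measurable_fst
    have h3 : Measurable fun p : ℂ × ℂ => conj ((k : ℂ) * p.2) :=
      (Complex.continuous_conj.comp (continuous_const.mul continuous_snd)).measurable
    have h4 : Measurable fun p : ℂ × ℂ => (m p.1 * conj ((k : ℂ) * p.2)).re :=
      Complex.measurable_re.comp (h2.mul h3)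
    have h5 : Measurable fun p : ℂ × ℂ => ‖(k : ℂ) * p.2‖ ^ 2 := by fun_prop
    exact measurable_const.sub (((h1.add h5).sub (h4.const_mul 2)).div_const D)
  -- the expectation of `f` under the joint law
  have hexpand : (fun ω => f (X ω, X ω + Z ω)) = fun ω => Real.log K
      - ((b (X ω) + k ^ 2 * ‖X ω‖ ^ 2 - 2 * k * (m (X ω) * conj (X ω)).re)
        + k ^ 2 * ‖Z ω‖ ^ 2
        + ((2 * (k : ℂ) ^ 2 * X ω - 2 * (k : ℂ) * m (X ω)) * conj (Z ω)).re) / D := by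
    ext ω
    simp only [hf, Complex.sq_norm, Complex.normSq_apply]
    congr 2
    simp [← Complex.ofReal_pow]
    ring
  have i1 := hint fun x => b x + k ^ 2 * ‖x‖ ^ 2 - 2 * k * (m x * conj x).re
  obtain ⟨iZ, eZ⟩ := hZ.integral_norm_sq
  have i2 := iZ.const_mul (k ^ 2)
  obtain ⟨i3, e3⟩ := hZ.integral_re_mul_conj_eq_zero hXZ
    (g := fun x => 2 * (k : ℂ) ^ 2 * x - 2 * (k : ℂ) * m x) (by fun_prop)
    (hint fun x => (2 * (k : ℂ) ^ 2 * x - 2 * (k : ℂ) * m x).re)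
    (hint fun x => (2 * (k : ℂ) ^ 2 * x - 2 * (k : ℂ) * m x).im)
  have i12 : Integrable (fun ω => (b (X ω) + k ^ 2 * ‖X ω‖ ^ 2
      - 2 * k * (m (X ω) * conj (X ω)).re) + k ^ 2 * ‖Z ω‖ ^ 2) μ := i1.add i2
  have i4 : Integrable (fun ω => ((b (X ω) + k ^ 2 * ‖X ω‖ ^ 2
      - 2 * k * (m (X ω) * conj (X ω)).re) + k ^ 2 * ‖Z ω‖ ^ 2
      + ((2 * (k : ℂ) ^ 2 * X ω - 2 * (k : ℂ) * m (X ω)) * conj (Z ω)).re) / D) μ :=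
    (i12.add i3).div_const D
  have hfint : Integrable (fun ω => f (X ω, X ω + Z ω)) μ := by
    rw [hexpand]
    exact (integrable_const _).sub i4
  have e1 : ∫ ω, (b (X ω) + k ^ 2 * ‖X ω‖ ^ 2 - 2 * k * (m (X ω) * conj (X ω)).re) ∂μ
      = (∑ x ∈ S, (b x + k ^ 2 * ‖x‖ ^ 2 - 2 * k * (m x * conj x).re)) / (S.card : ℝ) := by
    rw [← integral_uniformOn_finset, ← hX.integral_comp]
    · rfl
    · exact (integrable_uniformOn_finset hS _).aestronglyMeasurable
  have hEf : Real.log K - 1 ≤ ∫ p, f p ∂(μ.map fun ω => (X ω, X ω + Z ω)) := by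
    rw [integral_map hXYm hfm.aestronglyMeasurable, hexpand, integral_sub (integrable_const _) i4,
      integral_div, integral_add i12 i3, integral_add i1 i2, e1, e3, integral_const_mul, eZ]
    simp only [integral_const, probReal_univ, one_smul, add_zero]
    have : (∑ x ∈ S, (b x + k ^ 2 * ‖x‖ ^ 2 - 2 * k * (m x * conj x).re)) / S.card
      + k ^ 2 * 2 ≤ 1 * D := by linarith
    have := (div_le_iff₀ hD).2 this
    linarith
  have hexpm : Measurable fun p => Real.exp (f p) := hfm.exp
  -- the exponential moment of `f` under the product law, one value of `Y` at a time
  have hslice : ∀ y, ∫ x, Real.exp (f (x, y)) ∂(μ.map X) ≤ 1 := fun y => by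
    rw [hX.map_eq, integral_uniformOn_finset, div_le_one hcard]
    refine le_trans (le_of_eq ?_) (hcover (k * y))
    rw [Finset.mul_sum]
    refine Finset.sum_congr rfl fun x _ => ?_
    rw [hf]
    simp only
    rw [sub_eq_add_neg, Real.exp_add, Real.exp_log hK, neg_div]
  have hpos : ∀ y, 0 ≤ ∫ x, Real.exp (f (x, y)) ∂(μ.map X) := fun y =>
    integral_nonneg fun x => (Real.exp_pos _).le
  have hsm : StronglyMeasurable fun y => ∫ x, Real.exp (f (x, y)) ∂(μ.map X) :=
    hexpm.stronglyMeasurable.integral_prod_left'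
  have hsint : Integrable (fun y => ∫ x, Real.exp (f (x, y)) ∂(μ.map X))
      (μ.map fun ω => X ω + Z ω) :=
    Integrable.of_bound hsm.aestronglyMeasurable 1
      (.of_forall fun y => by rw [Real.norm_of_nonneg (hpos y)]; exact hslice y)
  have hexpint : Integrable (fun p => Real.exp (f p))
      ((μ.map X).prod (μ.map fun ω => X ω + Z ω)) := by
    rw [integrable_prod_iff' hexpm.aestronglyMeasurable]
    refine ⟨.of_forall fun y => ?_, ?_⟩
    · rw [hX.map_eq]
      exact integrable_uniformOn_finset hS _
    · simpa only [Real.norm_eq_abs, Real.abs_exp] using hsint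
  refine (ENNReal.ofReal_le_ofReal hEf).trans
    (ofReal_integral_le_klDiv_of_integral_exp_le_one ?_ hexpint ?_)
  · rw [integrable_map_measure hfm.aestronglyMeasurable hXYm]
    exact hfint
  · rw [integral_prod_symm _ hexpint]
    calc _ ≤ ∫ _, (1 : ℝ) ∂(μ.map fun ω => X ω + Z ω) :=
          integral_mono hsint (integrable_const _) hslice
      _ = 1 := by simp

open Real Set

/-! ### Gaussian integrals over polar cells -/

/-- The squared distance from `-r e^{iφ}` to `a + c i`, for `p = (r, φ)`. -/
noncomputable def polarSqDist (a c : ℝ) (p : ℝ × ℝ) : ℝ :=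
  p.1 ^ 2 + 2 * p.1 * (a * cos p.2 + c * sin p.2) + (a ^ 2 + c ^ 2)

/-- The polar rectangle `n Δ < r < (n + 1) Δ`, `l θₙ - π < φ < (l + 1) θₙ - π`
with `θₙ = 2 π / (2 n + 1)`. The angles are shifted by `-π` to fit the range `(-π, π)` of
`polarCoord`, so a pair `(r, φ)` stands for the point `-r e^{iφ}`. For `n = 0` this is a disc. -/
def polarCell (Δ : ℝ) (n l : ℕ) : Set (ℝ × ℝ) :=
  Ioo (n * Δ) ((n + 1) * Δ) ×ˢ
    Ioo (l * (2 * π / (2 * n + 1)) - π) ((l + 1) * (2 * π / (2 * n + 1)) - π)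

theorem integral_exp_neg_polarSqDist (a c : ℝ) {D : ℝ} (hD : 0 < D) :
    ∫ p in polarCoord.target, p.1 * exp (-polarSqDist a c p / D) = π * D := by
  have h := Complex.integral_comp_polarCoord_symm
    (fun z : ℂ => exp (-(1 / D) * ‖z + (⟨a, c⟩ : ℂ)‖ ^ 2))
  rw [integral_add_right_eq_self (fun z : ℂ => exp (-(1 / D) * ‖z‖ ^ 2)),
    GaussianFourier.integral_rexp_neg_mul_sq_norm (by positivity), Complex.finrank_real_complex]
    at h
  calc _ = _ := ?_
    _ = _ := h
    _ = _ := by norm_num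
  refine integral_congr_ae (.of_forall fun p => ?_)
  simp only [smul_eq_mul, Complex.polarCoord_symm_apply, Complex.sq_norm, Complex.normSq_apply,
    polarSqDist]
  congr 2
  simp [Complex.cos_ofReal_re, Complex.sin_ofReal_re, Complex.cos_ofReal_im, Complex.sin_ofReal_im]
  field_simp
  linear_combination p.1 ^ 2 * sin_sq_add_cos_sq p.2

theorem integrableOn_exp_neg_polarSqDist (a c : ℝ) {D : ℝ} (hD : 0 < D) :
    IntegrableOn (fun p : ℝ × ℝ => p.1 * exp (-polarSqDist a c p / D)) polarCoord.target := by
  -- otherwise the integral just computed would have the default value `0`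
  by_contra h
  have h0 := integral_exp_neg_polarSqDist a c hD
  rw [integral_undef h] at h0
  exact (mul_pos pi_pos hD).ne h0

theorem measurableSet_polarCell (Δ : ℝ) (n l : ℕ) : MeasurableSet (polarCell Δ n l) :=
  measurableSet_Ioo.prod measurableSet_Ioo

theorem polarCell_subset_target {Δ : ℝ} (hΔ : 0 < Δ) {n l : ℕ} (hl : l < 2 * n + 1) :
    polarCell Δ n l ⊆ polarCoord.target := by
  have hθ : (0 : ℝ) < 2 * π / (2 * n + 1) := by positivity
  have hfull : (2 * n + 1 : ℝ) * (2 * π / (2 * n + 1)) = 2 * π := by field_simp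
  have hl' : (l + 1 : ℝ) ≤ 2 * n + 1 := by exact_mod_cast hl
  rintro ⟨r, φ⟩ ⟨hr, hφ⟩
  simp only [mem_Ioo] at hr hφ
  refine ⟨lt_of_le_of_lt (by positivity) hr.1, ?_, ?_⟩
  · have : (0 : ℝ) ≤ l * (2 * π / (2 * n + 1)) := by positivity
    linarith [hφ.1]
  · nlinarith [hφ.2, mul_le_mul_of_nonneg_right hl' hθ.le]

theorem eq_of_mem_polarCell {Δ : ℝ} (hΔ : 0 < Δ) {n l n' l' : ℕ} {p : ℝ × ℝ}
    (h : p ∈ polarCell Δ n l) (h' : p ∈ polarCell Δ n' l') : n = n' ∧ l = l' := by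
  have key : ∀ {δ o x : ℝ} {i j : ℕ}, 0 < δ → i * δ - o < x → x < (j + 1) * δ - o → i ≤ j := by
    intro δ o x i j hδ h1 h2
    have : (i : ℝ) < j + 1 := lt_of_mul_lt_mul_right (by linarith) hδ.le
    exact Nat.lt_succ_iff.1 (by exact_mod_cast this)
  obtain ⟨⟨h1, h2⟩, h3, h4⟩ := h
  obtain ⟨⟨h1', h2'⟩, h3', h4'⟩ := h'
  have hn : n = n' := le_antisymm (key (o := 0) hΔ (by simpa using h1) (by simpa using h2'))
    (key (o := 0) hΔ (by simpa using h1') (by simpa using h2))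
  subst hn
  have hθ : (0 : ℝ) < 2 * π / (2 * n + 1) := by positivity
  exact ⟨rfl, le_antisymm (key hθ h3 h4') (key hθ h3' h4)⟩

theorem integral_Ioo_pow {a b : ℝ} (h : a ≤ b) (k : ℕ) :
    ∫ x in Ioo a b, x ^ k = (b ^ (k + 1) - a ^ (k + 1)) / (k + 1) := by
  rw [← integral_Ioc_eq_integral_Ioo, ← intervalIntegral.integral_of_le h, integral_pow]

theorem integral_Ioo_angle (n l : ℕ) :
    ∫ φ in Ioo (l * (2 * π / (2 * n + 1)) - π) ((l + 1) * (2 * π / (2 * n + 1)) - π), φ ^ 0 =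
      2 * π / (2 * n + 1) := by
  have hθ : (0 : ℝ) < 2 * π / (2 * n + 1) := by positivity
  rw [integral_Ioo_pow (by nlinarith)]
  simp only [zero_add, pow_one, Nat.cast_zero, div_one]
  ring

theorem setIntegral_polarCell_mul (Δ : ℝ) (n l : ℕ) (f g : ℝ → ℝ) :
    ∫ p in polarCell Δ n l, f p.1 * g p.2 = (∫ r in Ioo (n * Δ) ((n + 1) * Δ), f r) *
      ∫ φ in Ioo (l * (2 * π / (2 * n + 1)) - π) ((l + 1) * (2 * π / (2 * n + 1)) - π), g φ :=
  setIntegral_prod_mul f g _ _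

theorem integrableOn_polarCell_of_continuous (Δ : ℝ) (n l : ℕ) {F : ℝ × ℝ → ℝ}
    (hF : Continuous F) : IntegrableOn F (polarCell Δ n l) :=
  (hF.continuousOn.integrableOn_compact (isCompact_Icc.prod isCompact_Icc)).mono_set
    (prod_mono Ioo_subset_Icc_self Ioo_subset_Icc_self)

/-- Every cell has area `π Δ ^ 2`, whatever its ring. -/
theorem integral_polarCell_radius {Δ : ℝ} (hΔ : 0 < Δ) (n l : ℕ) :
    ∫ p in polarCell Δ n l, p.1 = π * Δ ^ 2 := by
  have h := setIntegral_polarCell_mul Δ n l (fun r => r ^ 1) (fun φ => φ ^ 0)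
  rw [integral_Ioo_pow (by nlinarith), integral_Ioo_angle] at h
  simp only [pow_one, pow_zero, mul_one] at h
  rw [h]
  field_simp
  push_cast
  ring

/-- The distance from the origin of the centroid of a cell of the `n`-th ring. -/
noncomputable def centroidRadius (Δ : ℝ) (n : ℕ) : ℝ :=
  2 / π * ((n : ℝ) ^ 2 + n + 1 / 3) * Δ * sin (π / (2 * n + 1))

/-- The integral over a cell of the squared distance to a given point, as the area of the cell
times the mean. -/
theorem integral_polarCell_polarSqDist {Δ : ℝ} (hΔ : 0 < Δ) (a c : ℝ) (n l : ℕ) :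
    ∫ p in polarCell Δ n l, p.1 * polarSqDist a c p = π * Δ ^ 2 *
      (Δ ^ 2 * ((n : ℝ) ^ 2 + n + 1 / 2) + (a ^ 2 + c ^ 2) - 2 * (centroidRadius Δ n *
        (a * cos ((l + 1 / 2) * (2 * π / (2 * n + 1))) +
          c * sin ((l + 1 / 2) * (2 * π / (2 * n + 1)))))) := by
  have hθ : (0 : ℝ) < 2 * π / (2 * n + 1) := by positivity
  have hr : (n : ℝ) * Δ ≤ (n + 1) * Δ := by nlinarith
  have hφ : (l : ℝ) * (2 * π / (2 * n + 1)) - π ≤ (l + 1) * (2 * π / (2 * n + 1)) - π := by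
    nlinarith
  have h3 := setIntegral_polarCell_mul Δ n l (fun r => r ^ 3) (fun φ => φ ^ 0)
  have h2 := setIntegral_polarCell_mul Δ n l (fun r => r ^ 2) (fun φ => a * cos φ + c * sin φ)
  have h1 := setIntegral_polarCell_mul Δ n l (fun r => r ^ 1) (fun φ => φ ^ 0)
  rw [integral_Ioo_pow hr, integral_Ioo_angle] at h3 h1
  have htrig : ∫ φ in Ioo (l * (2 * π / (2 * n + 1)) - π) ((l + 1) * (2 * π / (2 * n + 1)) - π),
      (a * cos φ + c * sin φ) = -2 * sin (π / (2 * n + 1)) *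
        (a * cos ((l + 1 / 2) * (2 * π / (2 * n + 1))) +
          c * sin ((l + 1 / 2) * (2 * π / (2 * n + 1)))) := by
    rw [← integral_Ioc_eq_integral_Ioo, ← intervalIntegral.integral_of_le hφ,
      intervalIntegral.integral_add ((by fun_prop : Continuous _).intervalIntegrable _ _)
        ((by fun_prop : Continuous _).intervalIntegrable _ _),
      intervalIntegral.integral_const_mul, intervalIntegral.integral_const_mul, integral_cos,
      integral_sin]
    have e1 : (l + 1 : ℝ) * (2 * π / (2 * n + 1))
        = (l + 1 / 2) * (2 * π / (2 * n + 1)) + π / (2 * n + 1) := by ring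
    have e2 : (l : ℝ) * (2 * π / (2 * n + 1))
        = (l + 1 / 2) * (2 * π / (2 * n + 1)) - π / (2 * n + 1) := by ring
    simp only [sin_sub_pi, cos_sub_pi]
    rw [e1, e2]
    simp only [sin_add, sin_sub, cos_add, cos_sub]
    ring
  rw [integral_Ioo_pow hr, htrig] at h2
  have hsplit : ∀ p : ℝ × ℝ, p.1 * polarSqDist a c p = p.1 ^ 3 * p.2 ^ 0
      + 2 * (p.1 ^ 2 * (a * cos p.2 + c * sin p.2)) + (a ^ 2 + c ^ 2) * (p.1 ^ 1 * p.2 ^ 0) := by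
    intro p
    rw [polarSqDist]
    ring
  simp only [hsplit]
  rw [integral_add, integral_add, integral_const_mul, integral_const_mul, h3, h2, h1,
    centroidRadius]
  · have hn : (2 * n + 1 : ℝ) ≠ 0 := by positivity
    generalize (a * cos ((l + 1 / 2) * (2 * π / (2 * n + 1))) +
          c * sin ((l + 1 / 2) * (2 * π / (2 * n + 1)))) = u
    generalize sin (π / (2 * n + 1)) = s
    field_simp
    push_cast
    ring
  all_goals exact integrableOn_polarCell_of_continuous Δ n l (by fun_prop)

/-- Jensen's inequality for the exponential on one cell: integrate the tangent line at the mean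
`q` of the squared distance. -/
theorem mul_exp_neg_le_integral_polarCell {Δ D : ℝ} (hΔ : 0 < Δ) (a c : ℝ)
    (n l : ℕ) {q : ℝ} (hq : ∫ p in polarCell Δ n l, p.1 * polarSqDist a c p = π * Δ ^ 2 * q) :
    π * Δ ^ 2 * exp (-q / D) ≤ ∫ p in polarCell Δ n l, p.1 * exp (-polarSqDist a c p / D) := by
  have hcont : Continuous (polarSqDist a c) := by unfold polarSqDist; fun_prop
  have i1 : IntegrableOn (fun p : ℝ × ℝ => exp (-q / D) * (1 + q / D) * p.1) (polarCell Δ n l) :=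
    integrableOn_polarCell_of_continuous Δ n l (by fun_prop)
  have i2 : IntegrableOn (fun p : ℝ × ℝ => exp (-q / D) / D * (p.1 * polarSqDist a c p))
      (polarCell Δ n l) := integrableOn_polarCell_of_continuous Δ n l (by fun_prop)
  calc π * Δ ^ 2 * exp (-q / D)
      = ∫ p in polarCell Δ n l, (exp (-q / D) * (1 + q / D) * p.1
          - exp (-q / D) / D * (p.1 * polarSqDist a c p)) := by
        rw [integral_sub i1 i2, integral_const_mul, integral_const_mul, hq,
          integral_polarCell_radius hΔ]
        ring
    _ ≤ _ := by
        refine setIntegral_mono_on (i1.sub i2)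
          (integrableOn_polarCell_of_continuous Δ n l (by fun_prop))
          (measurableSet_polarCell Δ n l) fun p hp => ?_
        have hp0 : 0 ≤ p.1 := le_trans (by positivity) hp.1.1.le
        have htangent := add_one_le_exp (-polarSqDist a c p / D - -q / D)
        have hsum : exp (-polarSqDist a c p / D)
            = exp (-q / D) * exp (-polarSqDist a c p / D - -q / D) := by
          rw [← exp_add]; congr 1; ring
        rw [hsum]
        calc _ = p.1 * (exp (-q / D) * (-polarSqDist a c p / D - -q / D + 1)) := by ring
          _ ≤ _ := by gcongr

/-- A Gaussian mass bound over all cells: they tile a disc, on which the Gaussian integral is at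
most its value `π D` on the plane. -/
theorem sum_exp_neg_le {Δ D : ℝ} (hΔ : 0 < Δ) (hD : 0 < D) (a c : ℝ) (N : ℕ) :
    ∑ n ∈ Finset.range N, ∑ l ∈ Finset.range (2 * n + 1), Δ ^ 2 *
      exp (-(Δ ^ 2 * ((n : ℝ) ^ 2 + n + 1 / 2) + (a ^ 2 + c ^ 2) - 2 * (centroidRadius Δ n *
        (a * cos ((l + 1 / 2) * (2 * π / (2 * n + 1))) +
          c * sin ((l + 1 / 2) * (2 * π / (2 * n + 1)))))) / D) ≤ D := by
  set T := (Finset.range N).sigma fun n => Finset.range (2 * n + 1) with hT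
  have hsub : (⋃ i ∈ T, polarCell Δ i.1 i.2) ⊆ polarCoord.target := by
    refine iUnion₂_subset fun i hi => polarCell_subset_target hΔ ?_
    simpa using (Finset.mem_sigma.1 hi).2
  have hint := integrableOn_exp_neg_polarSqDist a c hD
  have hdisj : (T : Set (Σ _ : ℕ, ℕ)).PairwiseDisjoint fun i => polarCell Δ i.1 i.2 := by
    rintro ⟨n, l⟩ - ⟨n', l'⟩ - hne
    refine Set.disjoint_left.2 fun p hp hp' => hne ?_
    obtain ⟨rfl, rfl⟩ := eq_of_mem_polarCell hΔ hp hp'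
    rfl
  have hunion := integral_biUnion_finset T
    (fun i _ => measurableSet_polarCell Δ i.1 i.2) hdisj
    (fun i hi => hint.mono_set ((subset_biUnion_of_mem (u := fun i : Σ _ : ℕ, ℕ =>
      polarCell Δ i.1 i.2) hi).trans hsub))
  have hmono : ∫ p in ⋃ i ∈ T, polarCell Δ i.1 i.2, p.1 * exp (-polarSqDist a c p / D)
      ≤ π * D := by
    rw [← integral_exp_neg_polarSqDist a c hD]
    refine setIntegral_mono_set hint ?_ hsub.eventuallyLE
    refine (ae_restrict_iff' polarCoord.open_target.measurableSet).2 (.of_forall fun p hp => ?_)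
    exact mul_nonneg (le_of_lt hp.1) (exp_pos _).le
  refine le_of_mul_le_mul_left ?_ pi_pos
  calc _ = ∑ i ∈ T, π * Δ ^ 2 *
        exp (-(Δ ^ 2 * ((i.1 : ℝ) ^ 2 + i.1 + 1 / 2) + (a ^ 2 + c ^ 2) -
          2 * (centroidRadius Δ i.1 * (a * cos ((i.2 + 1 / 2) * (2 * π / (2 * i.1 + 1))) +
            c * sin ((i.2 + 1 / 2) * (2 * π / (2 * i.1 + 1)))))) / D) := by
        rw [hT, Finset.sum_sigma, Finset.mul_sum]
        refine Finset.sum_congr rfl fun n _ => ?_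
        rw [Finset.mul_sum]
        exact Finset.sum_congr rfl fun l _ => (mul_assoc _ _ _).symm
    _ ≤ ∑ i ∈ T, ∫ p in polarCell Δ i.1 i.2, p.1 * exp (-polarSqDist a c p / D) :=
        Finset.sum_le_sum fun i _ => mul_exp_neg_le_integral_polarCell hΔ a c i.1 i.2
          (integral_polarCell_polarSqDist hΔ a c i.1 i.2)
    _ ≤ π * D := by rwa [← hunion]

/-! ### The points of the constellation and the moments of their cells -/

/-- The `l`-th point of the `n`-th ring, the zeroth ring being the origin. -/
noncomputable def ringPoint (Δ : ℝ) (n l : ℕ) : ℂ :=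
  if n = 0 then 0 else (((n : ℝ) + 1 / 2) * Δ : ℝ) *
    Complex.exp (Complex.I * (((l : ℝ) + 1 / 2) * (2 * π / (2 * (n : ℝ) + 1)) : ℝ))

/-- The pairs `(n, l)` that number the points of the first `N` rings. -/
def ringIndex (N : ℕ) : Finset (Σ _ : ℕ, ℕ) :=
  (Finset.range N).sigma fun n => Finset.range (2 * n + 1)

/-- The constellation as a finset; see `coe_ringFinset`. -/
noncomputable def ringFinset (N : ℕ) (Δ : ℝ) : Finset ℂ :=
  (ringIndex N).image fun i => ringPoint Δ i.1 i.2

theorem mem_ringIndex {N : ℕ} {i : Σ _ : ℕ, ℕ} :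
    i ∈ ringIndex N ↔ i.1 < N ∧ i.2 < 2 * i.1 + 1 := by
  simp [ringIndex]

theorem norm_ringPoint {Δ : ℝ} (hΔ : 0 < Δ) {n : ℕ} (hn : n ≠ 0) (l : ℕ) :
    ‖ringPoint Δ n l‖ = (n + 1 / 2) * Δ := by
  rw [ringPoint, if_neg hn, norm_mul, mul_comm Complex.I, Complex.norm_exp_ofReal_mul_I, mul_one,
    Complex.norm_real, norm_of_nonneg (by positivity)]

theorem ringPoint_zero (Δ : ℝ) (l : ℕ) : ringPoint Δ 0 l = 0 := if_pos rfl

theorem floor_norm_ringPoint {Δ : ℝ} (hΔ : 0 < Δ) (n l : ℕ) : ⌊‖ringPoint Δ n l‖ / Δ⌋₊ = n := by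
  rcases eq_or_ne n 0 with rfl | hn
  · simp [ringPoint_zero]
  · rw [norm_ringPoint hΔ hn, mul_div_cancel_right₀ _ hΔ.ne', Nat.floor_eq_iff (by positivity)]
    constructor <;> linarith

theorem ringPoint_injOn {Δ : ℝ} (hΔ : 0 < Δ) (N : ℕ) :
    InjOn (fun i : Σ _ : ℕ, ℕ => ringPoint Δ i.1 i.2) (ringIndex N) := by
  rintro ⟨n, l⟩ hi ⟨n', l'⟩ hi' h
  have hl := (mem_ringIndex.1 hi).2
  have hl' := (mem_ringIndex.1 hi').2
  simp only at h hl hl'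
  have hn : n = n' := by rw [← floor_norm_ringPoint hΔ n l, h, floor_norm_ringPoint hΔ]
  subst hn
  rcases eq_or_ne n 0 with rfl | hn
  · obtain rfl : l = l' := by omega
    rfl
  rw [ringPoint, ringPoint, if_neg hn, if_neg hn] at h
  have hr : ((((n : ℝ) + 1 / 2) * Δ : ℝ) : ℂ) ≠ 0 := by
    exact_mod_cast (by positivity : ((n : ℝ) + 1 / 2) * Δ ≠ 0)
  obtain ⟨j, hj⟩ := Complex.exp_eq_exp_iff_exists_int.1 (mul_left_cancel₀ hr h)
  have hj' : Complex.I * ((((l : ℝ) + 1 / 2) * (2 * π / (2 * (n : ℝ) + 1)) : ℝ) : ℂ)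
      = Complex.I * (((((l' : ℝ) + 1 / 2) * (2 * π / (2 * (n : ℝ) + 1)) + j * (2 * π)) : ℝ) : ℂ) := by
    rw [hj]
    push_cast
    ring
  have hreal := Complex.ofReal_injective (mul_left_cancel₀ Complex.I_ne_zero hj')
  have hlj : (l : ℝ) = l' + j * (2 * n + 1) := by
    have hn1 : (2 * (n : ℝ) + 1) ≠ 0 := by positivity
    field_simp at hreal
    linarith
  have hint : (l : ℤ) = l' + j * (2 * n + 1) := by exact_mod_cast hlj
  have hj0 : j = 0 := by
    by_contra hne
    rcases lt_or_gt_of_ne hne with hneg | hpos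
    · nlinarith
    · nlinarith
  obtain rfl : l = l' := by simpa [hj0] using hint
  rfl

theorem sum_ringFinset {Δ : ℝ} (hΔ : 0 < Δ) (N : ℕ) (F : ℂ → ℝ) :
    ∑ x ∈ ringFinset N Δ, F x =
      ∑ n ∈ Finset.range N, ∑ l ∈ Finset.range (2 * n + 1), F (ringPoint Δ n l) := by
  rw [ringFinset, Finset.sum_image (ringPoint_injOn hΔ N), ringIndex, Finset.sum_sigma]

theorem card_ringFinset {Δ : ℝ} (hΔ : 0 < Δ) (N : ℕ) : (ringFinset N Δ).card = N ^ 2 := by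
  rw [ringFinset, Finset.card_image_of_injOn (ringPoint_injOn hΔ N), ringIndex,
    Finset.card_sigma]
  simp only [Finset.card_range]
  induction N with
  | zero => rfl
  | succ N ih => rw [Finset.sum_range_succ, ih]; ring

theorem coe_ringFinset {N : ℕ} (hN : 0 < N) (Δ : ℝ) :
    (ringFinset N Δ : Set ℂ) = ringConstellation N Δ := by
  ext x
  simp only [ringFinset, Finset.coe_image, Set.mem_image, Finset.mem_coe, mem_ringIndex,
    ringConstellation, mem_union, mem_singleton_iff, mem_iUnion, mem_Ico, mem_Iic, exists_prop]
  constructor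
  · rintro ⟨⟨n, l⟩, ⟨hn, hl⟩, rfl⟩
    rcases eq_or_ne n 0 with rfl | hn0
    · exact .inl (ringPoint_zero _ _)
    · exact .inr ⟨n, ⟨by omega, hn⟩, l, Nat.lt_succ_iff.1 hl, by rw [ringPoint, if_neg hn0]⟩
  · rintro (rfl | ⟨n, ⟨hn1, hn⟩, l, hl, rfl⟩)
    · exact ⟨⟨0, 0⟩, ⟨hN, by simp⟩, ringPoint_zero _ _⟩
    · exact ⟨⟨n, l⟩, ⟨hn, Nat.lt_succ_iff.2 hl⟩, by
        simp only [ringPoint, if_neg (by omega : n ≠ 0)]⟩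

theorem sum_sq_norm_ringFinset {Δ : ℝ} (hΔ : 0 < Δ) {N : ℕ} (hN : 1 ≤ N) :
    ∑ x ∈ ringFinset N Δ, ‖x‖ ^ 2 = Δ ^ 2 * ((2 * N ^ 2 + 1) * (N ^ 2 - 1) / 4) := by
  rw [sum_ringFinset hΔ]
  induction N, hN using Nat.le_induction with
  | base => simp [ringPoint_zero]
  | succ N hN ih =>
    rw [Finset.sum_range_succ, ih]
    simp only [norm_ringPoint hΔ (by omega : N ≠ 0), Finset.sum_const, Finset.card_range,
      nsmul_eq_mul]
    push_cast
    ring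

theorem averagePower_eq {Ω : Type*} [MeasurableSpace Ω] {μ : Measure Ω} {X : Ω → ℂ} {N : ℕ}
    (hN : 1 ≤ N) {Δ : ℝ} (hΔ : 0 < Δ) (hX : HasLaw X (uniformOn (ringFinset N Δ : Set ℂ)) μ) :
    averagePower μ X = Δ ^ 2 * ((2 * N ^ 2 + 1) * (N ^ 2 - 1) / 4) / N ^ 2 := by
  have h := hX.integral_comp (f := fun x : ℂ => ‖x‖ ^ 2) (by fun_prop)
  rw [integral_uniformOn_finset, sum_sq_norm_ringFinset hΔ hN, card_ringFinset hΔ] at h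
  rw [averagePower]
  push_cast at h
  exact h

/-- The mean over the cell of the constellation point `x` of the squared distance to the origin.
The number of the ring of `x` is recovered as `⌊‖x‖ / Δ⌋₊`, which makes this a measurable function
on all of `ℂ`. -/
noncomputable def cellMoment (Δ : ℝ) (x : ℂ) : ℝ :=
  Δ ^ 2 * ((⌊‖x‖ / Δ⌋₊ : ℝ) ^ 2 + ⌊‖x‖ / Δ⌋₊ + 1 / 2)

/-- The centroid of the cell of the constellation point `x`. It lies on the ray through `x`; for
`x = 0` the cell is a disc and the quotient `_ / ‖x‖ = 0` gives the right value `0`. -/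
noncomputable def cellCentroid (Δ : ℝ) (x : ℂ) : ℂ :=
  ((centroidRadius Δ ⌊‖x‖ / Δ⌋₊ / ‖x‖ : ℝ) : ℂ) * x

theorem measurable_cellMoment (Δ : ℝ) : Measurable (cellMoment Δ) := by
  have h : Measurable fun x : ℂ => ⌊‖x‖ / Δ⌋₊ := Nat.measurable_floor.comp (by fun_prop)
  exact (measurable_from_nat (f := fun n : ℕ => Δ ^ 2 * ((n : ℝ) ^ 2 + n + 1 / 2))).comp h

theorem measurable_cellCentroid (Δ : ℝ) : Measurable (cellCentroid Δ) := by
  have h : Measurable fun x : ℂ => ⌊‖x‖ / Δ⌋₊ := Nat.measurable_floor.comp (by fun_prop)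
  have h' : Measurable fun x : ℂ => centroidRadius Δ ⌊‖x‖ / Δ⌋₊ :=
    (measurable_from_nat (f := centroidRadius Δ)).comp h
  exact (Complex.measurable_ofReal.comp (h'.div measurable_norm)).mul measurable_id

theorem cellMoment_ringPoint {Δ : ℝ} (hΔ : 0 < Δ) (n l : ℕ) :
    cellMoment Δ (ringPoint Δ n l) = Δ ^ 2 * ((n : ℝ) ^ 2 + n + 1 / 2) := by
  rw [cellMoment, floor_norm_ringPoint hΔ]

theorem centroidRadius_zero (Δ : ℝ) : centroidRadius Δ 0 = 0 := by
  simp [centroidRadius]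

theorem re_cellCentroid_ringPoint_mul_conj {Δ : ℝ} (hΔ : 0 < Δ) (n l : ℕ) (w : ℂ) :
    (cellCentroid Δ (ringPoint Δ n l) * conj w).re = centroidRadius Δ n *
      (w.re * cos ((l + 1 / 2) * (2 * π / (2 * n + 1))) +
        w.im * sin ((l + 1 / 2) * (2 * π / (2 * n + 1)))) := by
  rcases eq_or_ne n 0 with rfl | hn
  · simp [ringPoint_zero, cellCentroid, centroidRadius_zero]
  have hr : ((n : ℝ) + 1 / 2) * Δ ≠ 0 := by positivity
  rw [cellCentroid, floor_norm_ringPoint hΔ, norm_ringPoint hΔ hn, ringPoint, if_neg hn,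
    ← mul_assoc, ← Complex.ofReal_mul, div_mul_cancel₀ _ hr, mul_assoc, Complex.re_ofReal_mul,
    mul_comm Complex.I, Complex.mul_re, Complex.exp_ofReal_mul_I_re, Complex.exp_ofReal_mul_I_im,
    Complex.conj_re, Complex.conj_im]
  ring

theorem re_cellCentroid_ringPoint_mul_conj_self {Δ : ℝ} (hΔ : 0 < Δ) (n l : ℕ) :
    (cellCentroid Δ (ringPoint Δ n l) * conj (ringPoint Δ n l)).re =
      centroidRadius Δ n * ((n + 1 / 2) * Δ) := by
  rcases eq_or_ne n 0 with rfl | hn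
  · simp [ringPoint_zero, centroidRadius_zero]
  have hr : ((n : ℝ) + 1 / 2) * Δ ≠ 0 := by positivity
  rw [cellCentroid, floor_norm_ringPoint hΔ, mul_assoc, Complex.mul_conj,
    ← Complex.ofReal_mul, Complex.ofReal_re, Complex.normSq_eq_norm_sq, norm_ringPoint hΔ hn]
  field_simp

theorem sum_cellMoment_ringFinset {Δ : ℝ} (hΔ : 0 < Δ) (N : ℕ) :
    ∑ x ∈ ringFinset N Δ, cellMoment Δ x = Δ ^ 2 * (N ^ 4 / 2) := by
  rw [sum_ringFinset hΔ]
  induction N with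
  | zero => simp
  | succ N ih =>
    rw [Finset.sum_range_succ, ih]
    simp only [cellMoment_ringPoint hΔ, Finset.sum_const, Finset.card_range, nsmul_eq_mul]
    push_cast
    ring

/-! ### The mean squared error -/

/-- The contribution of the `n`-th ring to the correlation between a point and the centroid of its
cell. The loss against `‖x‖ ^ 2`, whose ring total is `2 (n + 1/2) ^ 3`, is close to
`(π ^ 2 - 2) / 12 * (n + 1/2)`, and `(π ^ 2 - 2) / 12 < 0.66` leaves room for the lower-order
remainder except on the innermost rings; the telescoping term `0.15 / n - 0.15 / (n + 1)` pays
for those. -/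
theorem le_ring_correlation {Δ : ℝ} {n : ℕ} (hn : 1 ≤ n) :
    Δ ^ 2 * (2 * ((n : ℝ) + 1 / 2) ^ 3 - 0.66 * (n + 1 / 2) - 0.15 / n + 0.15 / (n + 1)) ≤
      (2 * n + 1) * (centroidRadius Δ n * ((n + 1 / 2) * Δ)) := by
  have hn' : (1 : ℝ) ≤ n := by exact_mod_cast hn
  have hsin := sin_ge_sub_cube (x := π / (2 * n + 1)) (by positivity)
  have hpi : π ^ 2 ≤ 9.8697 := by nlinarith [pi_lt_d4, pi_pos]
  set r : ℝ := n + 1 / 2 with hr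
  have hrpos : 0 < r := by positivity
  have h2r : (2 * n + 1 : ℝ) = 2 * r := by rw [hr]; ring
  have hquad : (n : ℝ) ^ 2 + n + 1 / 3 = r ^ 2 + 1 / 12 := by rw [hr]; ring
  have hcr : (2 * n + 1) * (centroidRadius Δ n * (r * Δ))
      = Δ ^ 2 * (4 * r ^ 2 * (r ^ 2 + 1 / 12) / π * sin (π / (2 * n + 1))) := by
    rw [centroidRadius, hquad, h2r]
    ring
  rw [hcr]
  refine mul_le_mul_of_nonneg_left ?_ (sq_nonneg Δ)
  have hslack : 0.15 / r ^ 2 ≤ 0.15 / (n : ℝ) - 0.15 / (n + 1) := by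
    have : (0.15 : ℝ) / n - 0.15 / (n + 1) = 0.15 / (n * (n + 1)) := by field_simp; ring
    rw [this]
    apply div_le_div_of_nonneg_left (by norm_num) (by positivity)
    rw [hr]
    nlinarith
  have hcubic : 0 ≤ (0.66 + 1 / 6 - π ^ 2 / 12) * r ^ 3 - π ^ 2 / 144 * r + 0.15 := by
    have h1 : 0.00419 * r ^ 3 ≤ (0.66 + 1 / 6 - π ^ 2 / 12) * r ^ 3 := by
      gcongr
      linarith
    have h2 : π ^ 2 / 144 * r ≤ 0.06855 * r := by
      gcongr
      linarith
    -- `(r + 2 t) (r - t) ^ 2 = r ^ 3 - 3 t ^ 2 r + 2 t ^ 3`, with `t` near the minimum of the cubic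
    nlinarith [mul_nonneg (by linarith : (0 : ℝ) ≤ r + 4.6) (sq_nonneg (r - 2.3))]
  calc _ ≤ 2 * r ^ 3 - 0.66 * r - 0.15 / r ^ 2 := by linarith
    _ ≤ 2 * r * (r ^ 2 + 1 / 12) * (1 - π ^ 2 / (24 * r ^ 2)) := by
      rw [← sub_nonneg]
      have : 2 * r * (r ^ 2 + 1 / 12) * (1 - π ^ 2 / (24 * r ^ 2))
          - (2 * r ^ 3 - 0.66 * r - 0.15 / r ^ 2)
          = ((0.66 + 1 / 6 - π ^ 2 / 12) * r ^ 3 - π ^ 2 / 144 * r + 0.15) / r ^ 2 := by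
        field_simp
        ring
      rw [this]
      positivity
    _ = 4 * r ^ 2 * (r ^ 2 + 1 / 12) / π * (π / (2 * n + 1) - (π / (2 * n + 1)) ^ 3 / 6) := by
      rw [h2r]
      field_simp
      ring
    _ ≤ _ := by gcongr

/-- Lower bound for the total correlation between the points and the centroids of their cells. -/
theorem le_sum_re_cellCentroid_mul_conj {Δ : ℝ} (hΔ : 0 < Δ) {N : ℕ} (hN : 1 ≤ N) :
    Δ ^ 2 * ((2 * N ^ 2 + 1) * (N ^ 2 - 1) / 4 - 0.33 * N ^ 2 + 0.125 + 0.15 / N) ≤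
      ∑ x ∈ ringFinset N Δ, (cellCentroid Δ x * conj x).re := by
  rw [sum_ringFinset hΔ]
  simp only [re_cellCentroid_ringPoint_mul_conj_self hΔ, Finset.sum_const, Finset.card_range,
    nsmul_eq_mul]
  induction N, hN using Nat.le_induction with
  | base =>
    simp only [Finset.sum_range_one, centroidRadius_zero]
    norm_num
    nlinarith [sq_nonneg Δ]
  | succ N hN ih =>
    rw [Finset.sum_range_succ]
    have h := le_ring_correlation (Δ := Δ) hN
    push_cast at h ih ⊢
    refine le_trans (le_of_eq ?_) (add_le_add ih h)
    ring

/-- The mean squared error of the estimate `k Y` of a uniform point of the cell of `X`, with the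
Wiener coefficient `k = P / (P + 2)`. The term `k * P` of the bound on the correlation
combines with `k ^ 2 * (P + 2) = k * P` to `-k * P`, which cancels the leading part of the second
moment `Δ ^ 2 * N ^ 2 / 2` of the disc. -/
theorem distortion_le {Δ α P : ℝ} {N : ℕ} (hΔ : 0 < Δ) (hN : 1 ≤ N)
    (hP : P = Δ ^ 2 * ((2 * N ^ 2 + 1) * (N ^ 2 - 1) / 4) / N ^ 2)
    (hα : (N : ℝ) ^ 2 = α * (1 + P / 2)) :
    (∑ x ∈ ringFinset N Δ, (cellMoment Δ x + (P / (P + 2)) ^ 2 * ‖x‖ ^ 2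
        - 2 * (P / (P + 2)) * (cellCentroid Δ x * conj x).re)) / (ringFinset N Δ).card
      + 2 * (P / (P + 2)) ^ 2 ≤ Δ ^ 2 * (α + 1.82) / 2 := by
  have hN' : (1 : ℝ) ≤ N := by exact_mod_cast hN
  have hN2 : (1 : ℝ) ≤ (N : ℝ) ^ 2 := one_le_pow₀ hN'
  have hP0 : 0 ≤ P := by
    rw [hP]
    have : (0 : ℝ) ≤ N ^ 2 - 1 := by linarith
    positivity
  have hP2 : 0 < P + 2 := by linarith
  have hcorr := le_sum_re_cellCentroid_mul_conj hΔ hN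
  set G := ∑ x ∈ ringFinset N Δ, (cellCentroid Δ x * conj x).re
  set k := P / (P + 2) with hk
  have hk0 : 0 ≤ k := by positivity
  have hkP : k * (P + 2) = P := div_mul_cancel₀ _ hP2.ne'
  rw [Finset.sum_sub_distrib, Finset.sum_add_distrib, ← Finset.mul_sum, ← Finset.mul_sum,
    sum_cellMoment_ringFinset hΔ, sum_sq_norm_ringFinset hΔ hN, card_ringFinset hΔ]
  have hPN : Δ ^ 2 * ((2 * (N : ℝ) ^ 2 + 1) * (N ^ 2 - 1) / 4) = P * N ^ 2 := by
    rw [hP]; field_simp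
  have hG : P * N ^ 2 - Δ ^ 2 * (0.33 * N ^ 2 - 0.125) ≤ G := by
    have : 0 ≤ Δ ^ 2 * (0.15 / (N : ℝ)) := by positivity
    linarith
  rw [hPN]
  push_cast
  have hN0 : (0 : ℝ) < (N : ℝ) ^ 2 := by positivity
  have hkG := mul_le_mul_of_nonneg_left hG hk0
  calc _ = (Δ ^ 2 * ((N : ℝ) ^ 4 / 2) - 2 * (k * G)) / N ^ 2 + k * (k * (P + 2)) := by
        field_simp; ring
    _ ≤ (Δ ^ 2 * ((N : ℝ) ^ 4 / 2) - 2 * (k * (P * N ^ 2 - Δ ^ 2 * (0.33 * N ^ 2 - 0.125))))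
          / N ^ 2 + k * P := by
        rw [hkP]; gcongr
    _ = Δ ^ 2 * N ^ 2 / 2 - k * P + 2 * k * Δ ^ 2 * (0.33 - 0.125 / N ^ 2) := by
        field_simp; ring
    _ = (N ^ 2 * Δ ^ 2 + 0.91 * P * Δ ^ 2) / (P + 2) := by
        rw [hk, eq_div_iff hP2.ne']
        -- the closed form of `P`, solved for `Δ ^ 2 * N ^ 2 / 2`
        have hq : P * (Δ ^ 2 * N ^ 2 / 2 - P - Δ ^ 2 * (1 / 4 + 1 / (4 * N ^ 2))) = 0 := by
          rw [mul_eq_zero]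
          right
          rw [hP]
          field_simp
          ring
        field_simp at hq ⊢
        linear_combination hq / 4
    _ ≤ Δ ^ 2 * (α + 1.82) / 2 := by
        rw [div_le_iff₀ hP2]
        nlinarith [sq_nonneg Δ]

/-! ### The bound on the mutual information -/

/-- The bound in nats, with `1 + P / 2` eliminated in favour of `N ^ 2 / α`. -/
theorem ofReal_le_klDiv_ringConstellation {Ω : Type*} [MeasurableSpace Ω] {μ : Measure Ω} [IsProbabilityMeasure μ]
    {X Z : Ω → ℂ} {N : ℕ} {Δ α : ℝ} (hN : 1 ≤ N) (hΔ : 0 < Δ) (hα : 0 < α)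
    (hX : HasLaw X (uniformOn (ringConstellation N Δ)) μ) (hZ : IsComplexGaussianNoise μ Z)
    (hXZ : IndepFun X Z μ) (hαP : (N : ℝ) ^ 2 = α * (1 + averagePower μ X / 2)) :
    ENNReal.ofReal (log (N ^ 2) - 0.45 * log 2 - log (α + 1.82)) ≤
      klDiv (μ.map fun ω => (X ω, X ω + Z ω)) ((μ.map X).prod (μ.map fun ω => X ω + Z ω)) := by
  rw [← coe_ringFinset hN] at hX
  have hN0 : (0 : ℝ) < N := by exact_mod_cast hN
  have hcard := card_ringFinset hΔ N
  have hS : (ringFinset N Δ).Nonempty := by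
    rw [← Finset.card_pos, hcard]
    positivity
  set q : ℝ := exp (0.45 * log 2 - 1) with hq
  -- this is where `0.45` enters: `2 ^ 0.45 / e` is just above `1 / 2`
  have hq2 : 1 / 2 ≤ q := by
    rw [hq, ← log_le_iff_le_exp (by norm_num), one_div, log_inv]
    linarith [log_two_gt_d9]
  -- `D` is chosen so that `log (N ^ 2 * Δ ^ 2 / D) - 1` is the claimed bound
  set D := q * (Δ ^ 2 * (α + 1.82)) with hD
  have hDpos : 0 < D := by positivity
  have hdist := distortion_le hΔ hN (averagePower_eq hN hΔ hX) hαP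
  have hmain := log_sub_one_le_klDiv_map_prodMk hS hX hZ hXZ (measurable_cellCentroid Δ)
    (measurable_cellMoment Δ) (k := averagePower μ X / (averagePower μ X + 2)) hDpos
    (K := N ^ 2 * Δ ^ 2 / D) (by positivity) (fun w => ?_) (hdist.trans ?_)
  · have hlog : log (N ^ 2 * Δ ^ 2 / D) - 1 = log (N ^ 2) - 0.45 * log 2 - log (α + 1.82) := by
      have : (N : ℝ) ^ 2 * Δ ^ 2 / D = N ^ 2 / (q * (α + 1.82)) := by rw [hD]; field_simp
      rw [this, log_div (by positivity) (by positivity), log_mul (by positivity) (by positivity),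
        hq, log_exp]
      ring
    rwa [hlog] at hmain
  · have hcover := sum_exp_neg_le hΔ hDpos w.re w.im N
    simp only [← Finset.mul_sum] at hcover
    rw [hcard, sum_ringFinset hΔ, div_mul_eq_mul_div, div_le_iff₀ hDpos, mul_assoc]
    push_cast
    have hw : ‖w‖ ^ 2 = w.re ^ 2 + w.im ^ 2 := by
      rw [Complex.sq_norm, Complex.normSq_apply]
      ring
    simp only [cellMoment_ringPoint hΔ, re_cellCentroid_ringPoint_mul_conj hΔ, hw]
    exact mul_le_mul_of_nonneg_left hcover (sq_nonneg _)
  · rw [hD]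
    have : 0 ≤ Δ ^ 2 * (α + 1.82) := by positivity
    nlinarith

theorem mainTheorem8 :
    ∃ ε : ℕ → ℝ,
      Asymptotics.IsBigO Filter.atTop ε (fun N : ℕ => 1 / (N : ℝ) ^ 2) ∧
      ∀ (N : ℕ) (Δ α : ℝ), 2 ≤ N → 0 < Δ → 0 < α →
      ∀ (Ω : Type*) [MeasurableSpace Ω] (μ : MeasureTheory.Measure Ω)
        [MeasureTheory.IsProbabilityMeasure μ] (X Z : Ω → ℂ),
        ProbabilityTheory.HasLaw X (ProbabilityTheory.uniformOn (ringConstellation N Δ)) μ →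
        IsComplexGaussianNoise μ Z →
        ProbabilityTheory.IndepFun X Z μ →
        (N : ℝ) ^ 2 = α * (1 + averagePower μ X / 2) →
        0 < 1 + 1.82 / α + ε N ∧
        ((Real.logb 2 (1 + averagePower μ X / 2) - 0.45
            - Real.logb 2 (1 + 1.82 / α + ε N) : ℝ) : EReal)
          ≤ (mutualInfoBits μ X (fun ω => X ω + Z ω) : EReal) := by
  -- the estimates are sharp enough at every `N` for the zero sequence
  refine ⟨fun _ => 0, Asymptotics.isBigO_zero _ _, ?_⟩
  intro N Δ α hN hΔ hα Ω _ μ _ X Z hX hZ hXZ hαP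
  simp only [add_zero]
  refine ⟨by positivity, ?_⟩
  have hN0 : (0 : ℝ) < N := by exact_mod_cast (by omega : 0 < N)
  have hlog2 : 0 < log 2 := log_pos (by norm_num)
  have h := ENNReal.div_le_div_right
    (ofReal_le_klDiv_ringConstellation (by omega) hΔ hα hX hZ hXZ hαP) (ENNReal.ofReal (log 2))
  rw [← ENNReal.ofReal_div_of_pos hlog2] at h
  have hP : 1 + averagePower μ X / 2 = N ^ 2 / α := by rw [hαP]; field_simp
  have hsum : 1 + 1.82 / α = (α + 1.82) / α := by field_simp
  have hbits : logb 2 (1 + averagePower μ X / 2) - 0.45 - logb 2 (1 + 1.82 / α)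
      = (log (N ^ 2) - 0.45 * log 2 - log (α + 1.82)) / log 2 := by
    rw [hP, hsum, logb, logb, log_div (by positivity) hα.ne', log_div (by positivity) hα.ne']
    field_simp
    ring
  rw [hbits]
  calc _ ≤ ((ENNReal.ofReal ((log (N ^ 2) - 0.45 * log 2 - log (α + 1.82)) / log 2) : ℝ≥0∞) :
        EReal) := by
        rw [EReal.coe_ennreal_ofReal]
        exact_mod_cast le_max_left _ _
    _ ≤ _ := EReal.coe_ennreal_le_coe_ennreal_iff.2 h
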